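/- Let $V$ be a valuation domain of rank one with quotient field $K$, let $v$ be its valuation, with value group $\Gamma_v$ regarded as an ordered subgroup of $\mathbb{R}$ (and $v(0)=\infty$), and let $\overline{K}$ be an algebraic closure of $K$. A sequence $E=\{s_n\}_{n\in\mathbb{N}}$ in $K$ is *pseudo-convergent* if $v(s_{n+1}-s_n)<v(s_{n+2}-s_{n+1})$ for all $n$. Its *breadth* is $\delta_E=\lim_n v(s_{n+1}-s_n)\in\mathbb{R}\cup\{\infty\}$, and its *breadth ideal* is $\mathrm{Br}(E)=\{b\in K: v(b)>v(s_{n+1}-s_n)\text{ for all }n\}$. It is of *transcendental type* if $v(f(s_n))$ is eventually constant for every $f\in K[X]$, and of *algebraic type* if $v(f(s_n))$ is eventually strictly increasing for some $f\in K[X]$. Put $$V_E=\{\phi\in K(X): \phi(s_n)\in V\text{ for all but finitely many }n\},$$ $$w_E(\phi)=\lim_{n\to\infty}v(\phi(s_n))\in\mathbb{R}\cup\{\pm\infty\}\quad(\phi\in K(X)),\qquad W_E=\{\phi\in K(X): w_E(\phi)\ge 0\}.$$ For an extension $u$ of $v$ to $\overline{K}$ (again real-valued), let $\mathcal{L}_E^u=\{\alpha\in\overline{K}: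 u(\alpha-s_n)<u(\alpha-s_{n+1})\text{ for all }n\}$ be the set of *pseudo-limits* of $E$ in $\overline{K}$ with respect to $u$. Two pseudo-convergent sequences $E=\{s_n\}$ and $F=\{t_n\}$ in $K$ are *equivalent* if $\delta_E=\delta_F$ and for every $k$ there are $i_0,j_0$ such that $v(s_i-t_j)>v(t_{k+1}-t_k)$ for all $i\ge i_0$, $j\ge j_0$. **Theorem.** Let $E,F\subset K$ be pseudo-convergent sequences, each of which is either of transcendental type or of algebraic type with nonzero breadth ideal. Then the following are equivalent: (i) $E$ and $F$ are equivalent; (ii) $V_E=V_F$; (iii) $W_E=W_F$; (iv) $w_E=w_F$. Furthermore, if $E$ and $F$ are both of algebraic type, the previous conditions are equivalent to each of the following: (v) $\mathcal{L}_E^u=\mathcal{L}_F^u$ for all extensions $u$ of $v$ to $\overline{K}$; (vi) $\mathcal{L}_E^u=\mathcal{L}_F^u$ for some extension $u$ of $v$ to $\overline{K}$. -/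

import Mathlib

open Filter Topology

namespace PseudoConv

/-- The inclusion of `ℝ ∪ {∞}` into `ℝ ∪ {±∞}`. -/
noncomputable def toEReal (x : WithTop ℝ) : EReal :=
  WithTop.recTopCoe (⊤ : EReal) (fun r : ℝ => (r : EReal)) x

section Sequences

variable {L : Type*} [Field L]

/-- The sequence `s` is pseudo-convergent: `v (s (n+1) - s n)` is strictly increasing. -/
def IsPseudoConvergent (v : AddValuation L (WithTop ℝ)) (s : ℕ → L) : Prop :=
  ∀ n, v (s (n + 1) - s n) < v (s (n + 2) - s (n + 1))

/-- The breadth ideal (as a subset of the field). -/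
def breadthIdeal (v : AddValuation L (WithTop ℝ)) (s : ℕ → L) : Set L :=
  {b | ∀ n, v (s (n + 1) - s n) < v b}

/-- The breadth: the limit of `v (s (n+1) - s n)`. For a pseudo-convergent sequence these values
are increasing, so the limit exists in the extended reals. -/
noncomputable def breadth (v : AddValuation L (WithTop ℝ)) (s : ℕ → L) : EReal :=
  limUnder atTop fun n => toEReal (v (s (n + 1) - s n))

/-- The set of pseudo-limits of `s` in the valued field `(L, v)`. -/
def pseudoLimits (v : AddValuation L (WithTop ℝ)) (s : ℕ → L) : Set L :=
  {α | ∀ n, v (α - s n) < v (α - s (n + 1))}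

/-- `s` is of transcendental type: `v (f (s n))` is eventually constant for every polynomial. -/
def IsTranscendentalType (v : AddValuation L (WithTop ℝ)) (s : ℕ → L) : Prop :=
  ∀ f : Polynomial L, ∃ N, ∀ n ≥ N, v (f.eval (s n)) = v (f.eval (s N))

/-- `s` is of algebraic type: `v (f (s n))` is eventually strictly increasing for some
polynomial. -/
def IsAlgebraicType (v : AddValuation L (WithTop ℝ)) (s : ℕ → L) : Prop :=
  ∃ f : Polynomial L, ∃ N, ∀ n ≥ N, v (f.eval (s n)) < v (f.eval (s (n + 1)))

/-- Equivalence of the sequences `s` and `t`. -/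
def AreEquivalent (v : AddValuation L (WithTop ℝ)) (s t : ℕ → L) : Prop :=
  breadth v s = breadth v t ∧
    ∀ k, ∃ i₀ j₀, ∀ i ≥ i₀, ∀ j ≥ j₀, v (t (k + 1) - t k) < v (s i - t j)

/-- The set (ring) `V_s` of the rational functions `φ` with `φ (s n) ∈ V` for all but finitely
many `n`. The terms of a pseudo-convergent sequence are pairwise distinct, so that only finitely
many of them are poles of `φ`, and the value given to `φ` at a pole is irrelevant. -/
def assocRing (V : ValuationSubring L) (s : ℕ → L) : Set (RatFunc L) :=
  {φ | ∀ᶠ n in cofinite, φ.eval (RingHom.id L) (s n) ∈ V}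

/-- The map `w_s : φ ↦ lim v (φ (s n))`, with values in `ℝ ∪ {±∞}`. -/
noncomputable def ostrowskiMap (v : AddValuation L (WithTop ℝ)) (s : ℕ → L) :
    RatFunc L → EReal :=
  fun φ => limUnder atTop fun n => toEReal (v (φ.eval (RingHom.id L) (s n)))

/-- The set (ring) `W_s` of the rational functions `φ` with `w_s φ ≥ 0`. -/
def ostrowskiRing (v : AddValuation L (WithTop ℝ)) (s : ℕ → L) : Set (RatFunc L) :=
  {φ | 0 ≤ ostrowskiMap v s φ}

end Sequences

section Extensions

variable {K : Type*} [Field K]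

/-- `u` is an extension of the valuation `v` of `K` to the field `L`. -/
def IsExtension {L : Type*} [Field L] [Algebra K L]
    (v : AddValuation K (WithTop ℝ)) (u : AddValuation L (WithTop ℝ)) : Prop :=
  ∀ x : K, u (algebraMap K L x) = v x

/-- The pseudo-limits in `L`, with respect to the valuation `u` of `L`, of a sequence in the
subfield `K`. -/
def pseudoLimitsIn {L : Type*} [Field L] [Algebra K L]
    (u : AddValuation L (WithTop ℝ)) (s : ℕ → K) : Set L :=
  pseudoLimits u fun n => algebraMap K L (s n)

end Extensions

end PseudoConv

/-!
Let `d n = v (s (n+1) - s n)` be the gaps of a pseudo-convergent sequence `s`. They are real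
numbers increasing strictly to the breadth. In any valued extension of the field, a point `a` is
either a pseudo-limit of `s`, and then `a - s n` has value exactly `d n` for all `n`, or the value
of `a - s n` is eventually constant and smaller than some gap (`HasGaps.map_sub_of_mem`,
`HasGaps.exists_map_sub_of_notMem`). If `s` and `t` are equivalent, then the same alternative,
with the same constant, holds for both.

Extend `v` to a real valuation `u` of the algebraic closure (`exists_isExtension`) and factor a
rational function `φ ≠ 0` there: `v (φ (s n))` is eventually `l * d n + g`, where the integer `l`
is the number of zeros minus the number of poles of `φ` among the pseudo-limits, and an equivalent
sequence has the same `l` and `g` (`AreEquivalent.exists_map_ratFunc_eval`). As equivalent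
sequences also have mutually cofinal gaps, they define the same rings and the same map `w`.

Conversely, each of the two rings contains the linear functions `(X - t k) / (t (k+1) - t k)` if
it comes from `t`. If it comes from `s` as well, this says that the terms of `s` eventually lie
about as close to `t k` as those of `t` do, and this, with its mirror image, is enough for
equivalence (`AreEquivalent.of_eventually`).

A sequence of algebraic type has a pseudo-limit `a` in the algebraic closure, since otherwise the
slope `l` of every polynomial would be zero. Its pseudo-limits form the closed ball around `a`
whose radius is the breadth. The value group of `u` is dense, so that the ball determines its
radius, and two sequences with the same ball are equivalent
(`AreEquivalent.of_pseudoLimits_eq`).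
-/

namespace PseudoConv

/-! ### Extending a real valuation to an algebraic closure -/

/-- The order-reversing map `r ↦ exp (-r)` from `ℝ ∪ {∞}` to `ℝ`, with `∞ ↦ 0`. -/
noncomputable def expNeg (x : WithTop ℝ) : ℝ :=
  WithTop.recTopCoe 0 (fun r : ℝ => Real.exp (-r)) x

/-- The inverse `r ↦ -log r` of `expNeg` on the nonnegative reals, with `0 ↦ ∞`. -/
noncomputable def negLog (x : ℝ) : WithTop ℝ :=
  if x = 0 then ⊤ else ((-Real.log x : ℝ) : WithTop ℝ)

@[simp] lemma expNeg_top : expNeg ⊤ = 0 := rfl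

@[simp] lemma expNeg_coe (r : ℝ) : expNeg (r : WithTop ℝ) = Real.exp (-r) := rfl

lemma expNeg_nonneg (x : WithTop ℝ) : 0 ≤ expNeg x := by
  induction x with
  | top => simp
  | coe r => simpa using (Real.exp_pos _).le

lemma expNeg_eq_zero {x : WithTop ℝ} : expNeg x = 0 ↔ x = ⊤ := by
  induction x with
  | top => simp
  | coe r => simp

lemma expNeg_add (x y : WithTop ℝ) : expNeg (x + y) = expNeg x * expNeg y := by
  induction x with
  | top => simp
  | coe r =>
    induction y with
    | top => simp
    | coe t => rw [← WithTop.coe_add, expNeg_coe, expNeg_coe, expNeg_coe, ← Real.exp_add]; ring_nf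

lemma expNeg_antitone : Antitone expNeg := by
  intro x y h
  induction y with
  | top => simpa using expNeg_nonneg x
  | coe t =>
    induction x with
    | top => simp at h
    | coe r => simpa using h

lemma negLog_expNeg (x : WithTop ℝ) : negLog (expNeg x) = x := by
  induction x with
  | top => simp [negLog]
  | coe r => simp [negLog, Real.exp_ne_zero]

lemma negLog_mul (x y : ℝ) : negLog (x * y) = negLog x + negLog y := by
  by_cases hx : x = 0
  · simp [negLog, hx]
  by_cases hy : y = 0
  · simp [negLog, hy]
  simp only [negLog, mul_eq_zero, hx, hy, or_self, if_false]
  rw [← WithTop.coe_add, Real.log_mul hx hy]; ring_nf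

lemma negLog_anti {x y : ℝ} (hx : 0 ≤ x) (h : x ≤ y) : negLog y ≤ negLog x := by
  by_cases hx0 : x = 0
  · simp [negLog, hx0]
  have hx' : 0 < x := lt_of_le_of_ne hx (Ne.symm hx0)
  simp only [negLog, hx0, (hx'.trans_le h).ne', if_false]
  exact_mod_cast neg_le_neg (Real.log_le_log hx' h)

section

variable {K : Type*} [Field K] (v : AddValuation K (WithTop ℝ))

/-- The nonarchimedean absolute value `x ↦ exp (-v x)` attached to `v`. -/
noncomputable def absoluteValue : AbsoluteValue K ℝ where
  toFun x := expNeg (v x)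
  map_mul' x y := by rw [v.map_mul, expNeg_add]
  nonneg' x := expNeg_nonneg _
  eq_zero' x := by rw [expNeg_eq_zero, v.top_iff]
  add_le' x y := by
    refine (expNeg_antitone (v.map_add x y)).trans ?_
    rw [expNeg_antitone.map_min]
    exact max_le_add_of_nonneg (expNeg_nonneg _) (expNeg_nonneg _)

lemma zero_le_map_natCast (n : ℕ) : 0 ≤ v (n : K) := by
  induction n with
  | zero => simp
  | succ n ih =>
    rw [Nat.cast_succ]
    exact v.map_le_add ih v.map_one.ge

/-- A nontrivial real valuation extends to the algebraic closure: complete the field, and take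
the spectral norm on the algebraic closure of the completion. -/
theorem exists_isExtension (Kbar : Type*) [Field Kbar] [Algebra K Kbar]
    [Algebra.IsAlgebraic K Kbar] {c : K} (hc0 : c ≠ 0) (hc : 0 < v c) :
    ∃ u : AddValuation Kbar (WithTop ℝ), IsExtension v u := by
  let A := absoluteValue v
  let i : K →+* A.Completion :=
    (UniformSpace.Completion.coeRingHom).comp (WithAbs.equiv A).symm.toRingHom
  have hi : ∀ x, ‖i x‖ = expNeg (v x) := fun x =>
    (UniformSpace.Completion.norm_coe (E := WithAbs A) (WithAbs.toAbs A x)).trans rfl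
  have : IsUltrametricDist A.Completion := by
    refine IsUltrametricDist.isUltrametricDist_of_forall_norm_natCast_le_one fun n => ?_
    rw [← map_natCast i, hi]
    refine (expNeg_antitone (zero_le_map_natCast v n)).trans_eq ?_
    rw [← WithTop.coe_zero, expNeg_coe, neg_zero, Real.exp_zero]
  let : NontriviallyNormedField A.Completion :=
    { (inferInstance : NormedField A.Completion) with
      non_trivial := by
        refine ⟨i c⁻¹, ?_⟩
        obtain ⟨r, hr⟩ := WithTop.ne_top_iff_exists.mp (v.ne_top_iff.mpr hc0)
        have hr0 : 0 < r := by rw [← hr] at hc; exact_mod_cast hc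
        rw [hi, v.map_inv, ← hr]
        exact Real.one_lt_exp_iff.mpr (show (0 : ℝ) < - -r by simpa using hr0) }
  let M := AlgebraicClosure A.Completion
  let : Algebra K M := ((algebraMap A.Completion M).comp i).toAlgebra
  let j : Kbar →ₐ[K] M := IsAlgClosed.lift
  let N : MulAlgebraNorm A.Completion M := spectralMulAlgNorm A.Completion M
  have hN : IsNonarchimedean N := isNonarchimedean_spectralNorm
  refine ⟨AddValuation.of (fun x => negLog (N (j x))) (by simp [negLog]) (by simp [negLog])
    (fun x y => ?_) (fun x y => ?_), fun x => ?_⟩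
  · rw [map_add]
    rcases le_max_iff.mp (hN (j x) (j y)) with h | h
    · exact (min_le_left _ _).trans (negLog_anti (apply_nonneg N _) h)
    · exact (min_le_right _ _).trans (negLog_anti (apply_nonneg N _) h)
  · rw [map_mul, map_mul, negLog_mul]
  · rw [AddValuation.of_apply, j.commutes]
    have : N (algebraMap K M x) = ‖i x‖ := spectralNorm_extends (i x)
    rw [this, hi, negLog_expNeg]

end

/-! ### Gaps of pseudo-convergent sequences -/

section

variable {L : Type*} [Field L] {v : AddValuation L (WithTop ℝ)} {s t : ℕ → L} {d e : ℕ → ℝ}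

lemma lt_map_sub {x y : L} {g : WithTop ℝ} (hx : g < v x) (hy : g < v y) : g < v (x - y) :=
  (lt_min hx hy).trans_le (v.map_sub x y)

/-- The sequence `s` is pseudo-convergent with gaps `d n = v (s (n+1) - s n)`, recorded as real
numbers: the gaps are finite because they increase strictly. -/
structure HasGaps (v : AddValuation L (WithTop ℝ)) (s : ℕ → L) (d : ℕ → ℝ) : Prop where
  strictMono : StrictMono d
  map_succ_sub (n : ℕ) : v (s (n + 1) - s n) = d n

lemma IsPseudoConvergent.exists_hasGaps (hs : IsPseudoConvergent v s) :
    ∃ d, HasGaps v s d := by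
  have h : ∀ n, ∃ r : ℝ, (r : WithTop ℝ) = v (s (n + 1) - s n) := fun n =>
    WithTop.ne_top_iff_exists.mp (hs n).ne_top
  choose d hd using h
  refine ⟨d, strictMono_nat_of_lt_succ fun n => ?_, fun n => (hd n).symm⟩
  have := hs n
  rw [← hd n, ← hd (n + 1)] at this
  exact_mod_cast this

namespace HasGaps

lemma map_sub (hs : HasGaps v s d) {n m : ℕ} (h : n < m) : v (s m - s n) = d n := by
  induction m, h using Nat.le_induction with
  | base => exact hs.map_succ_sub n
  | succ m hm ih =>
    have hlt : v (s m - s n) < v (s (m + 1) - s m) := by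
      rw [ih, hs.map_succ_sub]
      exact_mod_cast hs.strictMono hm
    rw [← sub_add_sub_cancel (s (m + 1)) (s m) (s n), v.map_add_eq_of_lt_right hlt, ih]

lemma map_sub_eq_of_lt (hs : HasGaps v s d) {a : L} {n m : ℕ} (h : v (a - s n) < d n)
    (hnm : n ≤ m) : v (a - s m) = v (a - s n) := by
  rcases hnm.eq_or_lt with rfl | hlt
  · rfl
  rw [← hs.map_sub hlt] at h
  rw [← sub_sub_sub_cancel_right a (s m) (s n), v.map_sub_eq_of_lt_left h]

lemma mem_pseudoLimits_iff_le (hs : HasGaps v s d) {a : L} :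
    a ∈ pseudoLimits v s ↔ ∀ n, (d n : WithTop ℝ) ≤ v (a - s n) := by
  refine ⟨fun h n => ?_, fun h n => ?_⟩
  · by_contra! hlt
    exact (h n).ne (hs.map_sub_eq_of_lt hlt n.le_succ).symm
  · refine lt_of_not_ge fun hle => ?_
    have hlt : (d n : WithTop ℝ) < v (a - s (n + 1)) :=
      lt_of_lt_of_le (by exact_mod_cast hs.strictMono n.lt_succ_self) (h (n + 1))
    have h2 := lt_map_sub hlt (hlt.trans_le hle)
    rw [sub_sub_sub_cancel_left, v.map_sub_swap, hs.map_succ_sub] at h2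
    exact h2.false

/-- A pseudo-limit lies at distance exactly the `n`-th gap from the `n`-th term. -/
lemma map_sub_of_mem (hs : HasGaps v s d) {a : L} (h : a ∈ pseudoLimits v s) (n : ℕ) :
    v (a - s n) = d n := by
  rw [hs.mem_pseudoLimits_iff_le] at h
  have hlt : v (s (n + 1) - s n) < v (a - s (n + 1)) := by
    rw [hs.map_succ_sub]
    exact lt_of_lt_of_le (by exact_mod_cast hs.strictMono n.lt_succ_self) (h (n + 1))
  rw [← sub_add_sub_cancel a (s (n + 1)) (s n), v.map_add_eq_of_lt_right hlt, hs.map_succ_sub]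

/-- The distances from the terms to a point that is not a pseudo-limit are eventually a constant
below the gaps. -/
lemma exists_map_sub_of_notMem (hs : HasGaps v s d) {a : L} (h : a ∉ pseudoLimits v s) :
    ∃ (c : ℝ) (n : ℕ), c < d n ∧ ∀ m ≥ n, v (a - s m) = c := by
  rw [hs.mem_pseudoLimits_iff_le] at h
  push Not at h
  obtain ⟨n, hn⟩ := h
  obtain ⟨c, hc⟩ := WithTop.ne_top_iff_exists.mp hn.ne_top
  refine ⟨c, n, by rw [← hc] at hn; exact_mod_cast hn, fun m hm => ?_⟩
  rw [hs.map_sub_eq_of_lt hn hm, hc]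

lemma tendsto_iSup (hs : HasGaps v s d) :
    Tendsto (fun n => (d n : EReal)) atTop (𝓝 (⨆ n, (d n : EReal))) :=
  tendsto_atTop_iSup fun _ _ h => by exact_mod_cast hs.strictMono.monotone h

lemma breadth_eq (hs : HasGaps v s d) : breadth v s = ⨆ n, (d n : EReal) := by
  have : (fun n => toEReal (v (s (n + 1) - s n))) = fun n => (d n : EReal) := by
    funext n; rw [hs.map_succ_sub]; rfl
  rw [breadth, this]
  exact hs.tendsto_iSup.limUnder_eq

lemma lt_breadth (hs : HasGaps v s d) (n : ℕ) : (d n : EReal) < breadth v s := by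
  rw [hs.breadth_eq]
  exact lt_of_lt_of_le (by exact_mod_cast hs.strictMono n.lt_succ_self)
    (le_iSup (fun n => (d n : EReal)) (n + 1))

lemma breadth_le_iff (hs : HasGaps v s d) (ht : HasGaps v t e) :
    breadth v s ≤ breadth v t ↔ ∀ k, ∃ j, d k < e j := by
  refine ⟨fun h k => ?_, fun h => ?_⟩
  · have := (hs.lt_breadth k).trans_le h
    rw [ht.breadth_eq, lt_iSup_iff] at this
    exact_mod_cast this
  · rw [hs.breadth_eq]
    refine iSup_le fun k => ?_
    obtain ⟨j, hj⟩ := h k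
    exact (EReal.coe_lt_coe hj).le.trans (ht.lt_breadth j).le

end HasGaps

lemma AreEquivalent.refl (hs : HasGaps v s d) : AreEquivalent v s s := by
  refine ⟨rfl, fun k => ⟨k + 1, k + 1, fun i hi j hj => ?_⟩⟩
  rw [hs.map_succ_sub, ← sub_sub_sub_cancel_right (s i) (s j) (s k.succ)]
  have h : ∀ i ≥ k + 1, (d k : WithTop ℝ) < v (s i - s (k + 1)) := fun i hi => by
    rcases hi.eq_or_lt with rfl | hlt
    · simp
    · rw [hs.map_sub hlt]
      exact_mod_cast hs.strictMono k.lt_succ_self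
  exact lt_map_sub (h i hi) (h j hj)

lemma AreEquivalent.symm (hs : HasGaps v s d) (ht : HasGaps v t e) (h : AreEquivalent v s t) :
    AreEquivalent v t s := by
  refine ⟨h.1.symm, fun k => ?_⟩
  obtain ⟨k', hk'⟩ := (hs.breadth_le_iff ht).mp h.1.le k
  obtain ⟨i₀, j₀, hij⟩ := h.2 k'
  refine ⟨j₀, i₀, fun j hj i hi => ?_⟩
  have := hij i hi j hj
  rw [ht.map_succ_sub] at this
  rw [hs.map_succ_sub, v.map_sub_swap]
  exact lt_trans (by exact_mod_cast hk') this

/-- If the terms of each sequence eventually approach every term of the other one more closely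
than the preceding gap, then the sequences are equivalent. -/
lemma AreEquivalent.of_eventually (hs : HasGaps v s d) (ht : HasGaps v t e)
    (h₁ : ∀ k, ∀ᶠ i in atTop, (e k : WithTop ℝ) < v (s i - t (k + 1)))
    (h₂ : ∀ k, ∀ᶠ i in atTop, (d k : WithTop ℝ) < v (t i - s (k + 1))) :
    AreEquivalent v s t := by
  -- Two consecutive terms of `s` close to `t (k + 1)` force a gap of `s` above `e k`.
  have aux : ∀ {s t : ℕ → L} {d e : ℕ → ℝ}, HasGaps v s d →
      (∀ k, ∀ᶠ i in atTop, (e k : WithTop ℝ) < v (s i - t (k + 1))) → ∀ k, ∃ j, e k < d j := by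
    intro s t d e hs h k
    obtain ⟨N, hN⟩ := eventually_atTop.mp (h k)
    have := lt_map_sub (hN (N + 1) N.le_succ) (hN N le_rfl)
    rw [sub_sub_sub_cancel_right, hs.map_succ_sub] at this
    exact ⟨N, by exact_mod_cast this⟩
  refine ⟨le_antisymm ((hs.breadth_le_iff ht).mpr (aux ht h₂))
    ((ht.breadth_le_iff hs).mpr (aux hs h₁)), fun k => ?_⟩
  obtain ⟨N, hN⟩ := eventually_atTop.mp (h₁ k)
  refine ⟨N, k + 2, fun i hi j hj => ?_⟩
  rw [ht.map_succ_sub, ← sub_sub_sub_cancel_right (s i) (t j) (t (k + 1))]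
  refine lt_map_sub (hN i hi) ?_
  rw [ht.map_sub (show k + 1 < j from hj)]
  exact_mod_cast ht.strictMono k.lt_succ_self

/-- Equivalent sequences have the same pseudo-limits. -/
lemma AreEquivalent.pseudoLimits_subset (hs : HasGaps v s d) (ht : HasGaps v t e)
    (h : AreEquivalent v s t) : pseudoLimits v s ⊆ pseudoLimits v t := by
  intro a ha
  by_contra hna
  obtain ⟨c, n, hc, hconst⟩ := ht.exists_map_sub_of_notMem hna
  obtain ⟨i₀, j₀, hij⟩ := h.2 n
  obtain ⟨i₁, hi₁⟩ := (ht.breadth_le_iff hs).mp h.1.ge n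
  have h1 : (e n : WithTop ℝ) < v (a - s (max i₀ i₁)) := by
    rw [hs.map_sub_of_mem ha]
    exact_mod_cast hi₁.trans_le (hs.strictMono.monotone (le_max_right _ _))
  have h2 := hij (max i₀ i₁) (le_max_left _ _) (max j₀ n) (le_max_left _ _)
  rw [ht.map_succ_sub] at h2
  have h3 := v.map_lt_add h1 h2
  rw [sub_add_sub_cancel, hconst _ (le_max_right _ _)] at h3
  exact lt_asymm hc (by exact_mod_cast h3)

lemma AreEquivalent.pseudoLimits_eq (hs : HasGaps v s d) (ht : HasGaps v t e)
    (h : AreEquivalent v s t) : pseudoLimits v s = pseudoLimits v t :=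
  (h.pseudoLimits_subset hs ht).antisymm ((h.symm hs ht).pseudoLimits_subset ht hs)

/-! ### Values of polynomials and rational functions along a sequence -/

/-- Along two equivalent sequences, the distances to a point `a` follow the same pattern
`l * gap + g`, where `l = 1` at a pseudo-limit and `l = 0` elsewhere. -/
lemma AreEquivalent.exists_map_sub (hs : HasGaps v s d) (ht : HasGaps v t e)
    (h : AreEquivalent v s t) (a : L) :
    ∃ (l : ℕ) (g : ℝ), (pseudoLimits v s = ∅ → l = 0) ∧
      (∀ᶠ n in atTop, v (s n - a) = ((l * d n + g : ℝ) : WithTop ℝ)) ∧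
      ∀ᶠ n in atTop, v (t n - a) = ((l * e n + g : ℝ) : WithTop ℝ) := by
  by_cases ha : a ∈ pseudoLimits v s
  · refine ⟨1, 0, fun h0 => by simp [h0] at ha, .of_forall fun n => ?_, .of_forall fun n => ?_⟩
    · rw [v.map_sub_swap, hs.map_sub_of_mem ha]; simp
    · rw [v.map_sub_swap, ht.map_sub_of_mem (h.pseudoLimits_subset hs ht ha)]; simp
  · obtain ⟨c, n, hc, hconst⟩ := hs.exists_map_sub_of_notMem ha
    refine ⟨0, c, fun _ => rfl, eventually_atTop.mpr ⟨n, fun m hm => ?_⟩, ?_⟩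
    · rw [v.map_sub_swap, hconst m hm]; simp
    · obtain ⟨j₀, i₀, hij⟩ := (h.symm hs ht).2 n
      refine eventually_atTop.mpr ⟨j₀, fun j hj => ?_⟩
      have h1 := hij j hj (max i₀ n) (le_max_left _ _)
      have h2 := hconst (max i₀ n) (le_max_right _ _)
      rw [v.map_sub_swap] at h2
      rw [hs.map_succ_sub] at h1
      rw [← sub_add_sub_cancel (t j) (s (max i₀ n)) a, v.map_add_eq_of_lt_right, h2]
      · simp
      · rw [h2]; exact lt_trans (by exact_mod_cast hc) h1

/-- Along two equivalent sequences, the values of a split polynomial eventually follow the same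
affine function of the gaps. The slope `l` counts the roots that are pseudo-limits; only its
vanishing in their absence is recorded. -/
lemma AreEquivalent.exists_map_eval_of_splits (hs : HasGaps v s d) (ht : HasGaps v t e)
    (h : AreEquivalent v s t) {f : Polynomial L} (hf : f ≠ 0) (hsplit : f.Splits) :
    ∃ (l : ℕ) (g : ℝ), (pseudoLimits v s = ∅ → l = 0) ∧
      (∀ᶠ n in atTop, v (f.eval (s n)) = ((l * d n + g : ℝ) : WithTop ℝ)) ∧
      ∀ᶠ n in atTop, v (f.eval (t n)) = ((l * e n + g : ℝ) : WithTop ℝ) := by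
  have key : ∀ R : Multiset L, ∃ (l : ℕ) (g : ℝ), (pseudoLimits v s = ∅ → l = 0) ∧
      (∀ᶠ n in atTop, v ((R.map (s n - ·)).prod) = ((l * d n + g : ℝ) : WithTop ℝ)) ∧
      ∀ᶠ n in atTop, v ((R.map (t n - ·)).prod) = ((l * e n + g : ℝ) : WithTop ℝ) := by
    intro R
    induction R using Multiset.induction with
    | empty => exact ⟨0, 0, fun _ => rfl, by simp, by simp⟩
    | cons a R ih =>
      obtain ⟨l, g, h0, h1, h2⟩ := ih
      obtain ⟨l', g', h0', h1', h2'⟩ := h.exists_map_sub hs ht a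
      refine ⟨l + l', g + g', fun hh => by rw [h0 hh, h0' hh], ?_, ?_⟩
      · filter_upwards [h1, h1'] with n hn hn'
        rw [Multiset.map_cons, Multiset.prod_cons, v.map_mul, hn, hn', ← WithTop.coe_add]
        exact congrArg WithTop.some (by push_cast; ring)
      · filter_upwards [h2, h2'] with n hn hn'
        rw [Multiset.map_cons, Multiset.prod_cons, v.map_mul, hn, hn', ← WithTop.coe_add]
        exact congrArg WithTop.some (by push_cast; ring)
  obtain ⟨l, g, h0, h1, h2⟩ := key f.roots
  obtain ⟨c, hc⟩ := WithTop.ne_top_iff_exists.mp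
    (v.ne_top_iff.mpr (Polynomial.leadingCoeff_ne_zero.mpr hf))
  refine ⟨l, c + g, h0, ?_, ?_⟩
  · filter_upwards [h1] with n hn
    rw [hsplit.eval_eq_prod_roots, v.map_mul, hn, ← hc, ← WithTop.coe_add,
      add_left_comm]
  · filter_upwards [h2] with n hn
    rw [hsplit.eval_eq_prod_roots, v.map_mul, hn, ← hc, ← WithTop.coe_add,
      add_left_comm]

end

section

variable {K : Type*} [Field K] {L : Type*} [Field L] [Algebra K L]
  {v : AddValuation K (WithTop ℝ)} {u : AddValuation L (WithTop ℝ)}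
  {s t : ℕ → K} {d e : ℕ → ℝ}

lemma HasGaps.map (hs : HasGaps v s d) (hu : IsExtension v u) :
    HasGaps u (fun n => algebraMap K L (s n)) d :=
  ⟨hs.strictMono, fun n => by rw [← _root_.map_sub, hu, hs.map_succ_sub]⟩

lemma areEquivalent_map_iff (hs : HasGaps v s d) (ht : HasGaps v t e) (hu : IsExtension v u) :
    AreEquivalent u (fun n => algebraMap K L (s n)) (fun n => algebraMap K L (t n)) ↔
      AreEquivalent v s t := by
  simp only [AreEquivalent, (hs.map hu).breadth_eq, (ht.map hu).breadth_eq, hs.breadth_eq,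
    ht.breadth_eq, ← map_sub, hu _]

/-- Along two equivalent sequences, the values of a polynomial eventually follow the same affine
function of the gaps, of slope zero if there are no pseudo-limits in the algebraic closure. -/
lemma AreEquivalent.exists_map_eval [IsAlgClosed L] (hu : IsExtension v u)
    (hs : HasGaps v s d) (ht : HasGaps v t e) (h : AreEquivalent v s t)
    {f : Polynomial K} (hf : f ≠ 0) :
    ∃ (l : ℕ) (g : ℝ), (pseudoLimitsIn u s = ∅ → l = 0) ∧
      (∀ᶠ n in atTop, v (f.eval (s n)) = ((l * d n + g : ℝ) : WithTop ℝ)) ∧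
      ∀ᶠ n in atTop, v (f.eval (t n)) = ((l * e n + g : ℝ) : WithTop ℝ) := by
  have := ((areEquivalent_map_iff hs ht hu).mpr h).exists_map_eval_of_splits (hs.map hu)
    (ht.map hu) (f := f.map (algebraMap K L))
    ((Polynomial.map_ne_zero_iff (algebraMap K L).injective).mpr hf) (IsAlgClosed.splits _)
  simpa only [Polynomial.eval_map_apply, hu _, pseudoLimitsIn] using this

/-- Along two equivalent sequences, the values of a nonzero rational function eventually follow
the same affine function of the gaps. -/
lemma AreEquivalent.exists_map_ratFunc_eval [IsAlgClosed L] (hu : IsExtension v u)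
    (hs : HasGaps v s d) (ht : HasGaps v t e) (h : AreEquivalent v s t)
    {φ : RatFunc K} (hφ : φ ≠ 0) :
    ∃ l g : ℝ,
      (∀ᶠ n in atTop, v (φ.eval (RingHom.id K) (s n)) = ((l * d n + g : ℝ) : WithTop ℝ)) ∧
      ∀ᶠ n in atTop, v (φ.eval (RingHom.id K) (t n)) = ((l * e n + g : ℝ) : WithTop ℝ) := by
  obtain ⟨l, g, -, h1, h2⟩ := h.exists_map_eval hu hs ht (RatFunc.num_ne_zero hφ)
  obtain ⟨l', g', -, h1', h2'⟩ := h.exists_map_eval hu hs ht φ.denom_ne_zero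
  refine ⟨l - l', g - g', ?_, ?_⟩
  · filter_upwards [h1, h1'] with n hn hn'
    rw [RatFunc.eval, Polynomial.eval₂_id, Polynomial.eval₂_id, v.map_div, hn, hn',
      ← WithTop.LinearOrderedAddCommGroup.coe_sub]
    ring_nf
  · filter_upwards [h2, h2'] with n hn hn'
    rw [RatFunc.eval, Polynomial.eval₂_id, Polynomial.eval₂_id, v.map_div, hn, hn',
      ← WithTop.LinearOrderedAddCommGroup.coe_sub]
    ring_nf

/-! ### Equivalent sequences have the same associated rings -/

/-- Values following `l * gap + g` converge in the extended reals, to a limit determined by `l`,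
`g` and the breadth, even if the breadth is infinite. -/
lemma HasGaps.tendsto_toEReal (hs : HasGaps v s d) {x : ℕ → WithTop ℝ} {l g : ℝ}
    (hx : ∀ᶠ n in atTop, x n = ((l * d n + g : ℝ) : WithTop ℝ)) :
    Tendsto (fun n => toEReal (x n)) atTop (𝓝 (l * breadth v s + g)) := by
  have hlim : Tendsto (fun n => (l : EReal) * d n + g) atTop (𝓝 (l * breadth v s + g)) := by
    rw [hs.breadth_eq]
    have hmul : Tendsto (fun n => (l : EReal) * d n) atTop (𝓝 (l * ⨆ n, (d n : EReal))) :=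
      EReal.Tendsto.const_mul hs.tendsto_iSup (by simp) (by simp)
    exact (EReal.continuousAt_add (.inr (EReal.coe_ne_bot g))
      (.inr (EReal.coe_ne_top g))).tendsto.comp (hmul.prodMk_nhds tendsto_const_nhds)
  refine hlim.congr' ?_
  filter_upwards [hx] with n hn
  rw [hn]
  exact (by push_cast; rfl : ((l : EReal) * (d n : EReal) + g) = ((l * d n + g : ℝ) : EReal))

lemma AreEquivalent.ostrowskiMap_eq [IsAlgClosed L] (hu : IsExtension v u)
    (hs : HasGaps v s d) (ht : HasGaps v t e) (h : AreEquivalent v s t) :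
    ostrowskiMap v s = ostrowskiMap v t := by
  funext φ
  by_cases hφ : φ = 0
  · simp [ostrowskiMap, hφ]
  obtain ⟨l, g, h1, h2⟩ := h.exists_map_ratFunc_eval hu hs ht hφ
  rw [ostrowskiMap, ostrowskiMap, (hs.tendsto_toEReal h1).limUnder_eq,
    (ht.tendsto_toEReal h2).limUnder_eq, h.1]

lemma tendsto_ostrowskiMap [IsAlgClosed L] (hu : IsExtension v u) (hs : HasGaps v s d)
    {φ : RatFunc K} (hφ : φ ≠ 0) :
    Tendsto (fun n => toEReal (v (φ.eval (RingHom.id K) (s n)))) atTop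
      (𝓝 (ostrowskiMap v s φ)) := by
  obtain ⟨l, g, h1, -⟩ := (AreEquivalent.refl hs).exists_map_ratFunc_eval hu hs hs hφ
  rw [ostrowskiMap, (hs.tendsto_toEReal h1).limUnder_eq]
  exact hs.tendsto_toEReal h1

lemma mem_assocRing_iff {V : ValuationSubring K} (hv : ∀ x : K, x ∈ V ↔ 0 ≤ v x)
    {φ : RatFunc K} :
    φ ∈ assocRing V s ↔ ∀ᶠ n in atTop, 0 ≤ v (φ.eval (RingHom.id K) (s n)) := by
  simp only [assocRing, Set.mem_ofPred_eq, hv, Nat.cofinite_eq_atTop]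

lemma AreEquivalent.assocRing_subset [IsAlgClosed L] (hu : IsExtension v u)
    {V : ValuationSubring K} (hv : ∀ x : K, x ∈ V ↔ 0 ≤ v x)
    (hs : HasGaps v s d) (ht : HasGaps v t e) (h : AreEquivalent v s t) :
    assocRing V s ⊆ assocRing V t := by
  intro φ
  rw [mem_assocRing_iff hv, mem_assocRing_iff hv]
  intro hmem
  by_cases hφ : φ = 0
  · simp [hφ]
  obtain ⟨l, g, h1, h2⟩ := h.exists_map_ratFunc_eval hu hs ht hφ
  have hd : ∀ᶠ n in atTop, 0 ≤ l * d n + g := by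
    filter_upwards [hmem, h1] with n hn hn'
    rw [hn'] at hn
    exact_mod_cast hn
  obtain ⟨N, hN⟩ := eventually_atTop.mp hd
  -- The gaps of `s` and `t` are mutually cofinal, so nonnegativity of `l * gap + g` passes on:
  -- upwards from one gap if `0 ≤ l`, downwards from arbitrarily large gaps otherwise.
  have he : ∀ᶠ n in atTop, 0 ≤ l * e n + g := by
    rcases le_total 0 l with hl | hl
    · obtain ⟨j, hj⟩ := (hs.breadth_le_iff ht).mp h.1.le N
      refine eventually_atTop.mpr ⟨j, fun m hm => (hN N le_rfl).trans ?_⟩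
      have := hj.le.trans (ht.strictMono.monotone hm)
      gcongr
    · refine .of_forall fun m => ?_
      obtain ⟨j, hj⟩ := (ht.breadth_le_iff hs).mp h.1.ge m
      have := hj.le.trans (hs.strictMono.monotone (le_max_left j N))
      have := mul_le_mul_of_nonpos_left this hl
      linarith [hN (max j N) (le_max_right _ _)]
  filter_upwards [he, h2] with n hn hn'
  rw [hn']
  exact_mod_cast hn

/-! ### Recovering the sequence from its rings -/

lemma toEReal_strictMono : StrictMono toEReal := by
  intro x y h
  obtain ⟨a, rfl⟩ := WithTop.ne_top_iff_exists.mp h.ne_top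
  induction y with
  | top => exact EReal.coe_lt_top a
  | coe b => exact EReal.coe_lt_coe (by exact_mod_cast h)

/-- The linear function `(X - a) / b`. -/
noncomputable def linearRatFunc (a b : K) : RatFunc K :=
  algebraMap (Polynomial K) (RatFunc K) (Polynomial.C b⁻¹ * (Polynomial.X - Polynomial.C a))

lemma linearRatFunc_ne_zero (a : K) {b : K} (hb : b ≠ 0) : linearRatFunc a b ≠ 0 :=
  RatFunc.algebraMap_ne_zero
    (mul_ne_zero (by simpa using hb) (Polynomial.X_sub_C_ne_zero a))

lemma map_eval_linearRatFunc {a b : K} {r : ℝ} (hb : v b = r) (x : K) :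
    v ((linearRatFunc a b).eval (RingHom.id K) x) = v (x - a) + ((-r : ℝ) : WithTop ℝ) := by
  have : (linearRatFunc a b).eval (RingHom.id K) x = b⁻¹ * (x - a) := by
    rw [linearRatFunc, RatFunc.eval_algebraMap]
    simp
  rw [this, v.map_mul, v.map_inv, hb, add_comm]
  rfl

/-- The linear function `(X - t k) / (t (k+1) - t k)` takes values of valuation `0` along `t`. -/
lemma HasGaps.eventually_map_eval_eq_zero (ht : HasGaps v t e) (k : ℕ) :
    ∀ᶠ n in atTop,
      v ((linearRatFunc (t k) (t (k + 1) - t k)).eval (RingHom.id K) (t n)) = 0 := by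
  filter_upwards [eventually_gt_atTop k] with n hn
  rw [map_eval_linearRatFunc (ht.map_succ_sub k), ht.map_sub hn, ← WithTop.coe_add,
    add_neg_cancel, WithTop.coe_zero]

lemma HasGaps.eventually_lt_of_assocRing_subset (ht : HasGaps v t e)
    {V : ValuationSubring K} (hv : ∀ x : K, x ∈ V ↔ 0 ≤ v x)
    (h : assocRing V t ⊆ assocRing V s) (k : ℕ) :
    ∀ᶠ i in atTop, (e k : WithTop ℝ) < v (s i - t (k + 1)) := by
  have hmem := h ((mem_assocRing_iff hv).mpr
    ((ht.eventually_map_eval_eq_zero (k + 1)).mono fun n hn => hn.ge))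
  rw [mem_assocRing_iff hv] at hmem
  filter_upwards [hmem] with i hi
  rw [map_eval_linearRatFunc (ht.map_succ_sub _)] at hi
  have hk : e k < e (k + 1) := ht.strictMono k.lt_succ_self
  generalize v (s i - t (k + 1)) = x at hi
  induction x with
  | top => exact WithTop.coe_lt_top _
  | coe r =>
    have : 0 ≤ r + -e (k + 1) := by exact_mod_cast hi
    exact_mod_cast (by linarith : e k < r)

lemma HasGaps.eventually_lt_of_ostrowskiRing_subset [IsAlgClosed L] (hu : IsExtension v u)
    (hs : HasGaps v s d) (ht : HasGaps v t e)
    (h : ostrowskiRing v t ⊆ ostrowskiRing v s) (k : ℕ) :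
    ∀ᶠ i in atTop, (e k : WithTop ℝ) < v (s i - t (k + 1)) := by
  have hk : e k < e (k + 1) := ht.strictMono k.lt_succ_self
  have hb : t (k + 1 + 1) - t (k + 1) ≠ 0 := by
    rw [← v.ne_top_iff, ht.map_succ_sub]; exact WithTop.coe_ne_top
  have h0 : ostrowskiMap v t (linearRatFunc (t (k + 1)) (t (k + 1 + 1) - t (k + 1))) = 0 :=
    (tendsto_const_nhds.congr' <| (ht.eventually_map_eval_eq_zero (k + 1)).mono fun n hn => by
      rw [hn]; rfl : Tendsto _ atTop (𝓝 (0 : EReal))).limUnder_eq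
  have hmem : 0 ≤ ostrowskiMap v s _ := h (show 0 ≤ ostrowskiMap v t _ from h0.ge)
  have hneg : ((e k - e (k + 1) : ℝ) : EReal) < 0 := by exact_mod_cast sub_neg.mpr hk
  filter_upwards [(tendsto_ostrowskiMap hu hs (linearRatFunc_ne_zero _ hb)).eventually
    (lt_mem_nhds (hneg.trans_le hmem))] with i hi
  replace hi := toEReal_strictMono.lt_iff_lt.mp
    (show toEReal ((e k - e (k + 1) : ℝ) : WithTop ℝ) < _ from hi)
  rw [map_eval_linearRatFunc (ht.map_succ_sub _)] at hi
  generalize v (s i - t (k + 1)) = x at hi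
  induction x with
  | top => exact WithTop.coe_lt_top _
  | coe r =>
    have : e k - e (k + 1) < r + -e (k + 1) := by exact_mod_cast hi
    exact_mod_cast (by linarith : e k < r)

/-! ### Pseudo-limits of sequences of algebraic type -/

/-- A sequence of algebraic type has a pseudo-limit in the algebraic closure. -/
lemma IsAlgebraicType.nonempty_pseudoLimitsIn [IsAlgClosed L] (hu : IsExtension v u)
    (hs : HasGaps v s d) (h : IsAlgebraicType v s) : (pseudoLimitsIn u s).Nonempty := by
  obtain ⟨f, N, hN⟩ := h
  have hf : f ≠ 0 := by
    rintro rfl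
    simpa using hN N le_rfl
  by_contra hempty
  obtain ⟨l, g, hl, h1, -⟩ := (AreEquivalent.refl hs).exists_map_eval hu hs hs hf
  obtain ⟨M, hM⟩ := eventually_atTop.mp h1
  have hlt := hN (max N M) (le_max_left _ _)
  rw [hM _ (le_max_right _ _), hM _ ((le_max_right N M).trans (Nat.le_succ _)),
    hl (Set.not_nonempty_iff_eq_empty.mp hempty)] at hlt
  simp at hlt

/-- The value group of a nontrivially valued algebraically closed field is dense in `ℝ`: it
contains the values `(m / n) * v c`. -/
lemma exists_map_mem_Ioo [IsAlgClosed L] {c : L} {r : ℝ} (hc : u c = r) (hr : 0 < r) {x y : ℝ}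
    (hxy : x < y) : ∃ b : L, ∃ z : ℝ, x < z ∧ z < y ∧ u b = z := by
  obtain ⟨q, hq1, hq2⟩ := exists_rat_btwn (div_lt_div_of_pos_right hxy hr)
  rw [div_lt_iff₀ hr] at hq1
  rw [lt_div_iff₀ hr] at hq2
  obtain ⟨a, ha⟩ := IsAlgClosed.exists_pow_nat_eq c q.den_pos
  have hc0 : c ≠ 0 := by rw [← u.ne_top_iff, hc]; exact WithTop.coe_ne_top
  have ha0 : a ≠ 0 := by rintro rfl; exact hc0 (by rw [← ha, zero_pow q.den_ne_zero])
  obtain ⟨w, hw⟩ := WithTop.ne_top_iff_exists.mp (u.ne_top_iff.mpr ha0)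
  have hwr : q.den * w = r := by
    have := congrArg u ha
    rw [u.map_pow, ← hw, hc, ← WithTop.coe_nsmul, nsmul_eq_mul] at this
    exact_mod_cast this
  have hpow : ∀ n : ℕ, u (a ^ n) = ((n * w : ℝ) : WithTop ℝ) := fun n => by
    rw [u.map_pow, ← hw, ← WithTop.coe_nsmul, nsmul_eq_mul]
  refine ⟨a ^ q.num, q * r, hq1, hq2, ?_⟩
  have hqr : (q : ℝ) * r = q.num * w := by
    rw [← hwr, ← mul_assoc]
    congr 1
    exact_mod_cast q.mul_den_eq_num
  rw [hqr]
  obtain ⟨n, hn | hn⟩ := q.num.eq_nat_or_neg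
  · rw [hn, zpow_natCast, hpow]; simp
  · rw [hn, zpow_neg, zpow_natCast, u.map_inv, hpow]
    simp only [Int.cast_neg, Int.cast_natCast, neg_mul]
    rfl

end

section

variable {L : Type*} [Field L] [IsAlgClosed L] {u : AddValuation L (WithTop ℝ)}
  {s t : ℕ → L} {d e : ℕ → ℝ}

/-- If the ball of pseudo-limits of `s` is contained in that of `t`, its radius is at least as
large, since the value group is dense. -/
lemma HasGaps.breadth_le_of_pseudoLimits_subset (hs : HasGaps u s d) (ht : HasGaps u t e)
    (hne : (pseudoLimits u s).Nonempty) (h : pseudoLimits u s ⊆ pseudoLimits u t) :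
    breadth u t ≤ breadth u s := by
  obtain ⟨a, ha⟩ := hne
  by_contra! hlt
  rw [ht.breadth_eq, lt_iSup_iff] at hlt
  obtain ⟨k, hk⟩ := hlt
  obtain ⟨c, hc⟩ : ∃ c, u c = ((d 1 - d 0 : ℝ) : WithTop ℝ) :=
    ⟨(s 2 - s 1) / (s 1 - s 0), by
      rw [u.map_div, hs.map_succ_sub 1, hs.map_succ_sub 0,
        ← WithTop.LinearOrderedAddCommGroup.coe_sub]⟩
  obtain ⟨b, z, hz1, hz2, hb⟩ := exists_map_mem_Ioo hc (sub_pos.mpr (hs.strictMono zero_lt_one))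
    (ht.strictMono k.lt_succ_self)
  -- Moving `a` by `b`, with `breadth s < u b < breadth t`, stays within the pseudo-limits of `s`
  -- but leaves those of `t`.
  have hab : a + b ∈ pseudoLimits u s := by
    rw [hs.mem_pseudoLimits_iff_le]
    intro n
    rw [add_sub_right_comm]
    refine u.map_le_add (hs.map_sub_of_mem ha n).ge ?_
    have : (d n : EReal) < z := (hs.lt_breadth n).trans (hk.trans (EReal.coe_lt_coe hz1))
    rw [hb]
    exact_mod_cast this.le
  have hmem : b = (a + b - t (k + 1)) - (a - t (k + 1)) := by ring
  have hle := u.map_sub (a + b - t (k + 1)) (a - t (k + 1))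
  rw [← hmem, hb, ht.map_sub_of_mem (h hab), ht.map_sub_of_mem (h ha), min_self] at hle
  exact hz2.not_ge (by exact_mod_cast hle)

/-- The pseudo-limits of a sequence form a closed ball, of radius the breadth; two sequences with
the same ball have the same breadth, and are equivalent because they approach a common point. -/
lemma AreEquivalent.of_pseudoLimits_eq (hs : HasGaps u s d) (ht : HasGaps u t e)
    (hne : (pseudoLimits u s).Nonempty) (h : pseudoLimits u s = pseudoLimits u t) :
    AreEquivalent u s t := by
  have hbr : breadth u s = breadth u t :=
    le_antisymm (ht.breadth_le_of_pseudoLimits_subset hs (h ▸ hne) h.ge)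
      (hs.breadth_le_of_pseudoLimits_subset ht hne h.le)
  refine ⟨hbr, fun k => ?_⟩
  obtain ⟨a, ha⟩ := hne
  obtain ⟨i₀, hi₀⟩ := (ht.breadth_le_iff hs).mp hbr.ge k
  refine ⟨i₀, k + 1, fun i hi j hj => ?_⟩
  rw [ht.map_succ_sub, ← sub_sub_sub_cancel_left (t j) (s i) a]
  refine lt_map_sub ?_ ?_
  · rw [ht.map_sub_of_mem (h ▸ ha)]
    exact_mod_cast ht.strictMono hj
  · rw [hs.map_sub_of_mem ha]
    exact_mod_cast hi₀.trans_le (hs.strictMono.monotone hi)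

end

end PseudoConv

/-- `V` is a valuation ring of rank one of the field `K`, `v` is its valuation (the value group
being regarded as a subgroup of `ℝ`), `Kbar` is an algebraic closure of `K`, and `E`, `F` are
pseudo-convergent sequences in `K`, each of them either of transcendental type or of algebraic
type with nonzero breadth ideal. -/
theorem theorem5p3 {K : Type*} [Field K] {Kbar : Type*} [Field Kbar] [Algebra K Kbar]
    [IsAlgClosure K Kbar]
    (V : ValuationSubring K) (hV : ringKrullDim V = 1)
    (v : AddValuation K (WithTop ℝ)) (hv : ∀ x : K, x ∈ V ↔ 0 ≤ v x)
    (E F : ℕ → K)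
    (hE : PseudoConv.IsPseudoConvergent v E) (hF : PseudoConv.IsPseudoConvergent v F)
    (hE' : PseudoConv.IsTranscendentalType v E ∨
      (PseudoConv.IsAlgebraicType v E ∧ PseudoConv.breadthIdeal v E ≠ {0}))
    (hF' : PseudoConv.IsTranscendentalType v F ∨
      (PseudoConv.IsAlgebraicType v F ∧ PseudoConv.breadthIdeal v F ≠ {0})) :
    List.TFAE
      [PseudoConv.AreEquivalent v E F,
        PseudoConv.assocRing V E = PseudoConv.assocRing V F,
        PseudoConv.ostrowskiRing v E = PseudoConv.ostrowskiRing v F,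
        PseudoConv.ostrowskiMap v E = PseudoConv.ostrowskiMap v F] ∧
    (PseudoConv.IsAlgebraicType v E → PseudoConv.IsAlgebraicType v F →
      List.TFAE
        [PseudoConv.AreEquivalent v E F,
          PseudoConv.assocRing V E = PseudoConv.assocRing V F,
          PseudoConv.ostrowskiRing v E = PseudoConv.ostrowskiRing v F,
          PseudoConv.ostrowskiMap v E = PseudoConv.ostrowskiMap v F,
          ∀ u : AddValuation Kbar (WithTop ℝ), PseudoConv.IsExtension v u →
            PseudoConv.pseudoLimitsIn u E = PseudoConv.pseudoLimitsIn u F,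
          ∃ u : AddValuation Kbar (WithTop ℝ), PseudoConv.IsExtension v u ∧
            PseudoConv.pseudoLimitsIn u E = PseudoConv.pseudoLimitsIn u F]) := by
  have : IsAlgClosed Kbar := IsAlgClosure.isAlgClosed K
  have : Algebra.IsAlgebraic K Kbar := IsAlgClosure.isAlgebraic
  obtain ⟨d, hd⟩ := hE.exists_hasGaps
  obtain ⟨e, he⟩ := hF.exists_hasGaps
  -- The quotient of two successive differences of `E` has positive finite value.
  have hdiff : v ((E 2 - E 1) / (E 1 - E 0)) = ((d 1 - d 0 : ℝ) : WithTop ℝ) := by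
    rw [v.map_div, hd.map_succ_sub 1, hd.map_succ_sub 0,
      ← WithTop.LinearOrderedAddCommGroup.coe_sub]
  obtain ⟨u, hu⟩ := PseudoConv.exists_isExtension v Kbar
    (v.ne_top_iff.mp (hdiff ▸ WithTop.coe_ne_top))
    (hdiff ▸ by exact_mod_cast sub_pos.mpr (hd.strictMono zero_lt_one))
  have h12 : PseudoConv.AreEquivalent v E F →
      PseudoConv.assocRing V E = PseudoConv.assocRing V F := fun h =>
    (h.assocRing_subset hu hv hd he).antisymm ((h.symm hd he).assocRing_subset hu hv he hd)
  have h21 : PseudoConv.assocRing V E = PseudoConv.assocRing V F →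
      PseudoConv.AreEquivalent v E F := fun h =>
    .of_eventually hd he (he.eventually_lt_of_assocRing_subset hv h.ge)
      (hd.eventually_lt_of_assocRing_subset hv h.le)
  have h14 : PseudoConv.AreEquivalent v E F →
      PseudoConv.ostrowskiMap v E = PseudoConv.ostrowskiMap v F := fun h =>
    h.ostrowskiMap_eq hu hd he
  have h43 : PseudoConv.ostrowskiMap v E = PseudoConv.ostrowskiMap v F →
      PseudoConv.ostrowskiRing v E = PseudoConv.ostrowskiRing v F := fun h => by
    rw [PseudoConv.ostrowskiRing, PseudoConv.ostrowskiRing, h]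
  have h31 : PseudoConv.ostrowskiRing v E = PseudoConv.ostrowskiRing v F →
      PseudoConv.AreEquivalent v E F := fun h =>
    .of_eventually hd he (hd.eventually_lt_of_ostrowskiRing_subset hu he h.ge)
      (he.eventually_lt_of_ostrowskiRing_subset hu hd h.le)
  refine ⟨?_, fun hEalg _ => ?_⟩
  · tfae_have 1 → 2 := h12
    tfae_have 2 → 1 := h21
    tfae_have 1 → 4 := h14
    tfae_have 4 → 3 := h43
    tfae_have 3 → 1 := h31
    tfae_finish
  · tfae_have 1 → 2 := h12
    tfae_have 2 → 1 := h21
    tfae_have 1 → 4 := h14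
    tfae_have 4 → 3 := h43
    tfae_have 3 → 1 := h31
    tfae_have 1 → 5 := fun h u hu =>
      ((PseudoConv.areEquivalent_map_iff hd he hu).mpr h).pseudoLimits_eq (hd.map hu) (he.map hu)
    tfae_have 5 → 6 := fun h => ⟨u, hu, h u hu⟩
    tfae_have 6 → 1 := fun ⟨u, hu, h⟩ =>
      (PseudoConv.areEquivalent_map_iff hd he hu).mp
        (.of_pseudoLimits_eq (hd.map hu) (he.map hu) (hEalg.nonempty_pseudoLimitsIn hu hd) h)
    tfae_finish
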